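/- Let $\Psi(r)=r^4\left(\frac{r^2}{2}+\frac1r-\frac32\right)\mathbf 1(0\le r\le 1)$ for $r\ge 0$ (with $\Psi(0)=0$), let $r_*=(\sqrt5-1)/2$, and let $\chi(r)=-r^{-1}\Psi'(r)\,\mathbf 1(r_*\le r\le 1)$, which is non-negative. For a square-integrable real- or complex-valued function $f$ on $\mathbb R^3$ define the Hardy–Littlewood-type maximal function $$M^\chi_f(z)=\sup_{r>0}\left\{r^{-3}\int_{\mathbb R^3}\chi(|u|/r)\,|f(z+u)|\,du\right\}\in[0,\infty],\qquad z\in\mathbb R^3.$$ Then, for every square-integrable $f$ on $\mathbb R^3$, the function $M^\chi_f$ is measurable and $$\left(\int_{\mathbb R^3}M^\chi_f(z)^2\,dz\right)^{1/2}\le 7.5831\left(\int_{\mathbb R^3}|f(z)|^2\,dz\right)^{1/2}.$$ -/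

import Mathlib

open MeasureTheory

open scoped ENNReal

noncomputable section

/-- The profile `Ψ(r) = r⁴ (r²/2 + 1/r - 3/2) 1(0 ≤ r ≤ 1)`. -/
def Psi (r : ℝ) : ℝ :=
  (Set.Icc (0 : ℝ) 1).indicator (fun r => r ^ 4 * (r ^ 2 / 2 + 1 / r - 3 / 2)) r

/-- The point `r_* = (√5 - 1)/2` where `Ψ` attains its maximum. -/
def rStar : ℝ := (Real.sqrt 5 - 1) / 2

/-- The kernel `χ(r) = -r⁻¹ Ψ'(r) 1(r_* ≤ r ≤ 1)`. -/
def chi (r : ℝ) : ℝ :=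
  (Set.Icc rStar 1).indicator (fun r => -(r⁻¹ * deriv Psi r)) r

/-- The Hardy–Littlewood-type maximal function
`M^χ_f(z) = sup_{r > 0} r⁻³ ∫ χ(|u|/r) |f(z + u)| du`, with values in `[0, ∞]`.
Since `χ ≥ 0`, the passage to `ℝ≥0∞` loses nothing. -/
def maximalChi {𝕜 : Type*} [RCLike 𝕜] (f : EuclideanSpace ℝ (Fin 3) → 𝕜)
    (z : EuclideanSpace ℝ (Fin 3)) : ℝ≥0∞ :=
  ⨆ (r : ℝ) (_ : 0 < r),
    ENNReal.ofReal (r ^ 3)⁻¹ * ∫⁻ u, ENNReal.ofReal (chi (‖u‖ / r)) * ‖f (z + u)‖ₑ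

end

/-!
The kernel `χ` is continuous, at most `1/4`, and vanishes on `[1, ∞)`, so `M^χ_f` is lower
semicontinuous and is dominated by `(1/4) |B₁| = π/3` times the centred Hardy–Littlewood maximal
function `M |f|`. In dimension `d`, Vitali's lemma gives the weak-type bound
`t |{M g > t}| ≤ 2 ^ d ‖g‖₁`. Since `M g ≤ t / 2 + M (g - t / 2)₊`, it improves to
`t |{M g > t}| ≤ 2 ^ d ‖(2 g - t)₊‖₁`, and integrating this against `p t ^ (p - 2)` gives
`‖M g‖ₚ ^ p ≤ 2 ^ (d + p) / (p - 1) ‖g‖ₚ ^ p`. For `d = 3` and `p = 2` the factor is `32`, and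
`√32 π / 3 < 5.93 < 7.5831`.
-/

section LayerCake

variable {α β : Type*} [MeasurableSpace α] [MeasurableSpace β] {μ : Measure α} {ν : Measure β}
  {p : ℝ}

lemma setLIntegral_Ioi_ofReal_rpow (s : ℝ) :
    ∫⁻ t in Set.Ioi (0 : ℝ), ENNReal.ofReal (t ^ s) = ∞ := by
  by_contra h
  refine not_integrableOn_Ioi_rpow s ((lintegral_ofReal_ne_top_iff_integrable ?_ ?_).1 h)
  · exact (measurable_id.pow_const s).aestronglyMeasurable
  · exact (ae_restrict_mem measurableSet_Ioi).mono fun t ht => Real.rpow_nonneg (le_of_lt ht) s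

lemma lintegral_rpow_eq_lintegral_measure_lt_mul {F : α → ℝ≥0∞} (hF : AEMeasurable F μ)
    (hp : 0 < p) :
    ∫⁻ x, F x ^ p ∂μ = ENNReal.ofReal p *
      ∫⁻ t in Set.Ioi (0 : ℝ), μ {x | ENNReal.ofReal t < F x} * ENNReal.ofReal (t ^ (p - 1)) := by
  by_cases hfin : ∀ᵐ x ∂μ, F x ≠ ∞
  · calc ∫⁻ x, F x ^ p ∂μ = ∫⁻ x, ENNReal.ofReal ((F x).toReal ^ p) ∂μ := by
          refine lintegral_congr_ae (hfin.mono fun x hx => ?_)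
          simp only [← ENNReal.ofReal_rpow_of_nonneg ENNReal.toReal_nonneg hp.le,
            ENNReal.ofReal_toReal hx]
      _ = _ := lintegral_rpow_eq_lintegral_meas_lt_mul μ
          (Filter.Eventually.of_forall fun _ => ENNReal.toReal_nonneg) hF.ennreal_toReal hp
      _ = _ := by
          congr 1
          refine setLIntegral_congr_fun measurableSet_Ioi fun t ht => ?_
          congr 1
          refine measure_congr (hfin.mono fun x hx => propext ?_)
          exact (ENNReal.ofReal_lt_iff_lt_toReal (le_of_lt ht) hx).symm
  · have htop : μ {x | F x = ∞} ≠ 0 := by simpa only [ae_iff, not_not] using hfin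
    have hleft : ∫⁻ x, F x ^ p ∂μ = ∞ := by
      refine lintegral_eq_top_of_measure_eq_top_ne_zero (hF.pow_const p) ?_
      simpa only [ENNReal.rpow_eq_top_iff_of_pos hp] using htop
    have hright : ∫⁻ t in Set.Ioi (0 : ℝ),
        μ {x | ENNReal.ofReal t < F x} * ENNReal.ofReal (t ^ (p - 1)) = ∞ := by
      refine top_le_iff.1 ?_
      calc ∞ = μ {x | F x = ∞} * ∫⁻ t in Set.Ioi (0 : ℝ), ENNReal.ofReal (t ^ (p - 1)) := by
            rw [setLIntegral_Ioi_ofReal_rpow, ENNReal.mul_top htop]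
        _ ≤ ∫⁻ t in Set.Ioi (0 : ℝ), μ {x | F x = ∞} * ENNReal.ofReal (t ^ (p - 1)) :=
            lintegral_const_mul_le _ _
        _ ≤ _ := by
            refine lintegral_mono fun t => mul_le_mul_left (measure_mono fun x hx => ?_) _
            exact ENNReal.ofReal_lt_top.trans_eq (Eq.symm hx)
    rw [hleft, hright, ENNReal.mul_top (ENNReal.ofReal_pos.2 hp).ne']

lemma intervalIntegrable_rpow_mul_sub (hp : 1 < p) (b : ℝ) :
    IntervalIntegrable (fun t => t ^ (p - 2) * (b - t)) volume 0 b :=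
  (intervalIntegral.intervalIntegrable_rpow' (by linarith)).mul_continuousOn (by fun_prop)

lemma intervalIntegral_rpow_mul_sub (hp : 1 < p) {b : ℝ} (hb : 0 ≤ b) :
    ∫ t in (0 : ℝ)..b, t ^ (p - 2) * (b - t) = b ^ p / (p * (p - 1)) := by
  have hp₁ : p - 1 ≠ 0 := by linarith
  have hp₀ : p ≠ 0 := by linarith
  calc ∫ t in (0 : ℝ)..b, t ^ (p - 2) * (b - t)
      = ∫ t in (0 : ℝ)..b, (b * t ^ (p - 2) - t ^ (p - 1)) := by
        refine intervalIntegral.integral_congr_ae (Filter.Eventually.of_forall fun t ht => ?_)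
        rw [Set.uIoc_of_le hb] at ht
        rw [show p - 1 = p - 2 + 1 by ring, Real.rpow_add_one ht.1.ne']
        ring
    _ = b * (b ^ (p - 1) / (p - 1)) - b ^ p / p := by
        rw [intervalIntegral.integral_sub, intervalIntegral.integral_const_mul,
          integral_rpow (Or.inl (by linarith)), integral_rpow (Or.inl (by linarith))]
        · simp only [sub_add_cancel, show p - 2 + 1 = p - 1 by ring, Real.zero_rpow hp₁,
            Real.zero_rpow hp₀, sub_zero]
        · exact (intervalIntegral.intervalIntegrable_rpow' (by linarith)).const_mul b
        · exact intervalIntegral.intervalIntegrable_rpow' (by linarith)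
    _ = b ^ p / (p * (p - 1)) := by
        rw [mul_div_assoc', ← Real.rpow_one_add' hb (by linarith), add_sub_cancel]
        field_simp
        ring

lemma setLIntegral_Ioi_rpow_mul_sub (hp : 1 < p) (a : ℝ≥0∞) :
    ∫⁻ t in Set.Ioi (0 : ℝ), ENNReal.ofReal (t ^ (p - 2)) * (a - ENNReal.ofReal t) =
      ENNReal.ofReal (p * (p - 1))⁻¹ * a ^ p := by
  have hpp : 0 < (p * (p - 1))⁻¹ := inv_pos.2 (mul_pos (by linarith) (by linarith))
  rcases eq_or_ne a ∞ with rfl | ha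
  · simp only [ENNReal.top_sub ENNReal.ofReal_ne_top]
    rw [lintegral_mul_const _ (by fun_prop),
      setLIntegral_Ioi_ofReal_rpow, ENNReal.top_rpow_of_pos (by linarith),
      ENNReal.mul_top (ENNReal.ofReal_pos.2 hpp).ne', ENNReal.top_mul_top]
  lift a to NNReal using ha
  have hint : ∀ t ∈ Set.Ioi (0 : ℝ), ENNReal.ofReal (t ^ (p - 2)) * (a - ENNReal.ofReal t) =
      ENNReal.ofReal (t ^ (p - 2) * (a - t)) := fun t ht => by
    rw [ENNReal.ofReal_mul (Real.rpow_nonneg (le_of_lt ht) _),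
      ENNReal.ofReal_sub _ (le_of_lt ht), ENNReal.ofReal_coe_nnreal]
  have hzero : ∀ t ∈ Set.Ioi (a : ℝ), ENNReal.ofReal (t ^ (p - 2) * (a - t)) = 0 := fun t ht =>
    ENNReal.ofReal_of_nonpos (mul_nonpos_of_nonneg_of_nonpos
      (Real.rpow_nonneg (a.coe_nonneg.trans (le_of_lt ht)) _) (sub_nonpos.2 (le_of_lt ht)))
  calc _ = ∫⁻ t in Set.Ioi (0 : ℝ), ENNReal.ofReal (t ^ (p - 2) * (a - t)) :=
        setLIntegral_congr_fun measurableSet_Ioi hint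
    _ = ∫⁻ t in Set.Ioc 0 (a : ℝ), ENNReal.ofReal (t ^ (p - 2) * (a - t)) := by
        rw [← Set.Ioc_union_Ioi_eq_Ioi a.coe_nonneg,
          lintegral_union measurableSet_Ioi (Set.Ioc_disjoint_Ioi le_rfl),
          setLIntegral_eq_zero measurableSet_Ioi hzero, add_zero]
    _ = ENNReal.ofReal ((p * (p - 1))⁻¹ * (a : ℝ) ^ p) := by
        rw [← ofReal_integral_eq_lintegral_ofReal, ← intervalIntegral.integral_of_le a.coe_nonneg,
          intervalIntegral_rpow_mul_sub hp a.coe_nonneg, div_eq_inv_mul]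
        · exact (intervalIntegrable_iff_integrableOn_Ioc_of_le a.coe_nonneg).1
            (intervalIntegrable_rpow_mul_sub hp a)
        · exact (ae_restrict_mem measurableSet_Ioc).mono fun t ht =>
            mul_nonneg (Real.rpow_nonneg ht.1.le _) (sub_nonneg.2 ht.2)
    _ = _ := by
        rw [ENNReal.ofReal_mul hpp.le, ← ENNReal.ofReal_rpow_of_nonneg a.coe_nonneg
          (by linarith), ENNReal.ofReal_coe_nnreal]

lemma lintegral_rpow_le_of_forall_mul_measure_lt_le [SFinite ν] {F : α → ℝ≥0∞} {g : β → ℝ≥0∞}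
    (hF : AEMeasurable F μ) (hg : AEMeasurable g ν) (hp : 1 < p) {A : ℝ≥0∞}
    (hFg : ∀ t : ℝ, 0 < t → ENNReal.ofReal t * μ {x | ENNReal.ofReal t < F x} ≤
      A * ∫⁻ y, (g y - ENNReal.ofReal t) ∂ν) :
    ∫⁻ x, F x ^ p ∂μ ≤ A * ENNReal.ofReal (p - 1)⁻¹ * ∫⁻ y, g y ^ p ∂ν := by
  have hp₀ : 0 < p := by linarith
  have hmeas : AEMeasurable (fun q : ℝ × β =>
      ENNReal.ofReal (q.1 ^ (p - 2)) * (g q.2 - ENNReal.ofReal q.1))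
      ((volume.restrict (Set.Ioi 0)).prod ν) :=
    (measurable_fst.pow_const _).ennreal_ofReal.aemeasurable.mul
      (hg.comp_snd.sub measurable_fst.ennreal_ofReal.aemeasurable)
  have hlevel : ∀ t ∈ Set.Ioi (0 : ℝ),
      μ {x | ENNReal.ofReal t < F x} * ENNReal.ofReal (t ^ (p - 1)) ≤
        A * ∫⁻ y, ENNReal.ofReal (t ^ (p - 2)) * (g y - ENNReal.ofReal t) ∂ν := fun t ht => by
    have ht : 0 < t := ht
    calc _ = ENNReal.ofReal (t ^ (p - 2)) *
          (ENNReal.ofReal t * μ {x | ENNReal.ofReal t < F x}) := by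
          rw [show p - 1 = p - 2 + 1 by ring, Real.rpow_add_one ht.ne',
            ENNReal.ofReal_mul (Real.rpow_nonneg ht.le _)]
          ring
      _ ≤ ENNReal.ofReal (t ^ (p - 2)) * (A * ∫⁻ y, (g y - ENNReal.ofReal t) ∂ν) :=
          mul_le_mul_right (hFg t ht) _
      _ = _ := by
          rw [lintegral_const_mul' _ _ ENNReal.ofReal_ne_top, mul_left_comm]
  calc ∫⁻ x, F x ^ p ∂μ
      = ENNReal.ofReal p * ∫⁻ t in Set.Ioi (0 : ℝ),
          μ {x | ENNReal.ofReal t < F x} * ENNReal.ofReal (t ^ (p - 1)) :=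
        lintegral_rpow_eq_lintegral_measure_lt_mul hF hp₀
    _ ≤ ENNReal.ofReal p * ∫⁻ t in Set.Ioi (0 : ℝ),
          A * ∫⁻ y, ENNReal.ofReal (t ^ (p - 2)) * (g y - ENNReal.ofReal t) ∂ν :=
        mul_le_mul_right (setLIntegral_mono' measurableSet_Ioi hlevel) _
    _ = ENNReal.ofReal p * (A * ∫⁻ y, (∫⁻ t in Set.Ioi (0 : ℝ),
          ENNReal.ofReal (t ^ (p - 2)) * (g y - ENNReal.ofReal t)) ∂ν) := by
        rw [lintegral_const_mul'' _ hmeas.lintegral_prod_right', lintegral_lintegral_swap hmeas]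
    _ ≤ ENNReal.ofReal p * (A * ∫⁻ y, ENNReal.ofReal (p * (p - 1))⁻¹ * g y ^ p ∂ν) := by
        gcongr with y
        exact (setLIntegral_Ioi_rpow_mul_sub hp (g y)).le
    _ = A * ENNReal.ofReal (p - 1)⁻¹ * ∫⁻ y, g y ^ p ∂ν := by
        rw [lintegral_const_mul' _ _ ENNReal.ofReal_ne_top, mul_inv,
          ENNReal.ofReal_mul (inv_pos.2 hp₀).le, ENNReal.ofReal_inv_of_pos hp₀]
        have := ENNReal.mul_inv_cancel (ENNReal.ofReal_pos.2 hp₀).ne' ENNReal.ofReal_ne_top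
        calc _ = (ENNReal.ofReal p * (ENNReal.ofReal p)⁻¹) *
              (A * ENNReal.ofReal (p - 1)⁻¹ * ∫⁻ y, g y ^ p ∂ν) := by ring
          _ = _ := by rw [this, one_mul]

end LayerCake

section Covering

lemma exists_countable_pairwiseDisjoint_ball_cover {X : Type*} [PseudoMetricSpace X]
    [TopologicalSpace.SeparableSpace X] {S : Set X} {ρ : X → ℝ} {R τ : ℝ} (hτ : 1 < τ)
    (hρ : ∀ z ∈ S, 0 < ρ z) (hR : ∀ z ∈ S, ρ z ≤ R) :
    ∃ u ⊆ S, u.Countable ∧ u.PairwiseDisjoint (fun z => Metric.ball z (ρ z)) ∧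
      S ⊆ ⋃ z ∈ u, Metric.ball z ((1 + τ) * ρ z) := by
  obtain ⟨u, huS, hdisj, hcover⟩ := Vitali.exists_disjoint_subfamily_covering_enlargement
    (fun z => Metric.ball z (ρ z)) S ρ τ hτ (fun z hz => (hρ z hz).le) R hR
    fun z hz => Metric.nonempty_ball.2 (hρ z hz)
  refine ⟨u, huS, hdisj.countable_of_isOpen (fun _ _ => Metric.isOpen_ball)
    fun z hz => Metric.nonempty_ball.2 (hρ z (huS hz)), hdisj, fun z hz => ?_⟩
  obtain ⟨y, hy, ⟨x, hxz, hxy⟩, hzy⟩ := hcover z hz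
  refine Set.mem_biUnion hy (Metric.mem_ball.2 ?_)
  linarith [dist_triangle_left z y x, Metric.mem_ball.1 hxz, Metric.mem_ball.1 hxy]

variable {E : Type*} [NormedAddCommGroup E] [NormedSpace ℝ E] [FiniteDimensional ℝ E]
  [Nontrivial E] [MeasurableSpace E] [BorelSpace E] {μ : Measure E} [μ.IsAddHaarMeasure]

lemma exists_forall_radius_le_of_mul_measure_ball_le {c I : ℝ≥0∞} (hc : c ≠ 0) (hI : I ≠ ∞) :
    ∃ R : ℝ, ∀ (z : E) (r : ℝ), 0 < r → c * μ (Metric.ball z r) ≤ I → r ≤ R := by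
  have hV : μ (Metric.ball (0 : E) 1) ≠ 0 := (Metric.measure_ball_pos μ 0 one_pos).ne'
  have hcV : c * μ (Metric.ball (0 : E) 1) ≠ 0 := mul_ne_zero hc hV
  refine ⟨max 1 (I / (c * μ (Metric.ball (0 : E) 1))).toReal, fun z r hr hle => ?_⟩
  have hpow : r ^ Module.finrank ℝ E ≤ (I / (c * μ (Metric.ball (0 : E) 1))).toReal := by
    rw [← ENNReal.ofReal_le_iff_le_toReal (ENNReal.div_ne_top hI hcV),
      ENNReal.le_div_iff_mul_le (Or.inl hcV) (Or.inr hI), mul_left_comm,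
      ← Measure.addHaar_ball_of_pos μ z hr]
    exact hle
  rcases le_total r 1 with h1 | h1
  · exact le_max_of_le_left h1
  · exact le_max_of_le_right ((le_self_pow₀ h1 Module.finrank_pos.ne').trans hpow)

lemma mul_measure_le_ofReal_pow_mul_lintegral {h : E → ℝ≥0∞} {c : ℝ≥0∞} {S : Set E}
    (hI : ∫⁻ w, h w ∂μ ≠ ∞)
    (hS : ∀ z ∈ S, ∃ r > 0, c * μ (Metric.ball z r) ≤ ∫⁻ w in Metric.ball z r, h w ∂μ)
    {τ : ℝ} (hτ : 1 < τ) :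
    c * μ S ≤ ENNReal.ofReal ((1 + τ) ^ Module.finrank ℝ E) * ∫⁻ w, h w ∂μ := by
  rcases eq_or_ne c 0 with rfl | hc
  · simp only [zero_mul, zero_le]
  choose! ρ hρ hle using hS
  obtain ⟨R, hR⟩ := exists_forall_radius_le_of_mul_measure_ball_le (μ := μ) hc hI
  obtain ⟨u, huS, hu, hdisj, hcover⟩ := exists_countable_pairwiseDisjoint_ball_cover hτ hρ
    fun z hz => hR z (ρ z) (hρ z hz) ((hle z hz).trans (setLIntegral_le_lintegral _ _))
  set K := ENNReal.ofReal ((1 + τ) ^ Module.finrank ℝ E)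
  calc c * μ S ≤ c * ∑' z : u, μ (Metric.ball (z : E) ((1 + τ) * ρ z)) :=
        mul_le_mul_right ((measure_mono hcover).trans (measure_biUnion_le _ hu _)) _
    _ = ∑' z : u, K * (c * μ (Metric.ball (z : E) (ρ z))) := by
        rw [← ENNReal.tsum_mul_left]
        refine tsum_congr fun z => ?_
        rw [Measure.addHaar_ball_mul_of_pos μ _ (by linarith), mul_left_comm,
          Measure.addHaar_ball_center μ (z : E)]
    _ ≤ ∑' z : u, K * ∫⁻ w in Metric.ball (z : E) (ρ z), h w ∂μ := by
        gcongr with z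
        exact hle z (huS z.2)
    _ = K * ∫⁻ w in ⋃ z ∈ u, Metric.ball z (ρ z), h w ∂μ := by
        rw [ENNReal.tsum_mul_left,
          lintegral_biUnion hu (fun _ _ => Metric.isOpen_ball.measurableSet) hdisj]
    _ ≤ K * ∫⁻ w, h w ∂μ := mul_le_mul_right (setLIntegral_le_lintegral _ _) _

-- Only the centres of the balls have to be covered, so Vitali's constant `3` drops to `2`.
lemma mul_measure_le_two_pow_mul_lintegral {h : E → ℝ≥0∞} {c : ℝ≥0∞} {S : Set E}
    (hS : ∀ z ∈ S, ∃ r > 0, c * μ (Metric.ball z r) ≤ ∫⁻ w in Metric.ball z r, h w ∂μ) :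
    c * μ S ≤ 2 ^ Module.finrank ℝ E * ∫⁻ w, h w ∂μ := by
  rcases eq_or_ne (∫⁻ w, h w ∂μ) ∞ with hI | hI
  · rw [hI, ENNReal.mul_top (pow_ne_zero _ two_ne_zero)]
    exact le_top
  have hlim : Filter.Tendsto
      (fun τ : ℝ => ENNReal.ofReal ((1 + τ) ^ Module.finrank ℝ E) * ∫⁻ w, h w ∂μ)
      (nhdsWithin 1 (Set.Ioi 1)) (nhds (2 ^ Module.finrank ℝ E * ∫⁻ w, h w ∂μ)) := by
    refine (Continuous.tendsto' ?_ _ _ ?_).mono_left nhdsWithin_le_nhds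
    · exact (ENNReal.continuous_mul_const hI).comp (ENNReal.continuous_ofReal.comp (by fun_prop))
    · rw [one_add_one_eq_two, ENNReal.ofReal_pow zero_le_two, ENNReal.ofReal_ofNat]
  exact ge_of_tendsto hlim (eventually_mem_nhdsWithin.mono fun τ hτ =>
    mul_measure_le_ofReal_pow_mul_lintegral hI hS hτ)

end Covering

section LowerSemicontinuity

lemma lowerSemicontinuous_lintegral {X α : Type*} [TopologicalSpace X]
    [FirstCountableTopology X] [MeasurableSpace α] {μ : Measure α} {F : X → α → ℝ≥0∞}
    (hmeas : ∀ x, AEMeasurable (F x) μ) (hF : ∀ᵐ a ∂μ, LowerSemicontinuous fun x => F x a) :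
    LowerSemicontinuous fun x => ∫⁻ a, F x a ∂μ := fun x =>
  lowerSemicontinuousAt_iff_le_liminf.2 <|
    (lintegral_mono_ae (hF.mono fun _ ha => lowerSemicontinuousAt_iff_le_liminf.1 (ha x))).trans
    (lintegral_liminf_le' hmeas)

lemma lowerSemicontinuous_const_mul {X : Type*} [TopologicalSpace X] {F : X → ℝ≥0∞}
    (hF : LowerSemicontinuous F) {c : ℝ≥0∞} (hc : c ≠ ∞) :
    LowerSemicontinuous fun x => c * F x :=
  (ENNReal.continuous_const_mul hc).comp_lowerSemicontinuous hF fun _ _ h => mul_le_mul_right h c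

end LowerSemicontinuity

section CenteredMaximal

/-- The centred Hardy–Littlewood maximal function over open balls. -/
noncomputable def centeredMaximal {X : Type*} [PseudoMetricSpace X] [MeasurableSpace X]
    (μ : Measure X) (g : X → ℝ≥0∞) (z : X) : ℝ≥0∞ :=
  ⨆ (r : ℝ) (_ : 0 < r), ⨍⁻ w in Metric.ball z r, g w ∂μ

section Metric

variable {X : Type*} [PseudoMetricSpace X] [MeasurableSpace X] {μ : Measure X}

lemma centeredMaximal_const_mul (g : X → ℝ≥0∞) {c : ℝ≥0∞} (hc : c ≠ ∞) (z : X) :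
    centeredMaximal μ (fun w => c * g w) z = c * centeredMaximal μ g z := by
  simp only [centeredMaximal, setLAverage_eq, lintegral_const_mul' c g hc, mul_div_assoc,
    ENNReal.mul_iSup]

lemma centeredMaximal_le_add_centeredMaximal_tsub [ProperSpace X] [μ.IsOpenPosMeasure]
    [IsFiniteMeasureOnCompacts μ] (g : X → ℝ≥0∞) (t : ℝ≥0∞) (z : X) :
    centeredMaximal μ g z ≤ t + centeredMaximal μ (fun w => g w - t) z := by
  refine iSup₂_le fun r hr => ?_
  calc ⨍⁻ w in Metric.ball z r, g w ∂μ
      ≤ ⨍⁻ w in Metric.ball z r, (t + (g w - t)) ∂μ :=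
        setLAverage_mono_ae _ (Filter.Eventually.of_forall fun _ => le_add_tsub)
    _ = t + ⨍⁻ w in Metric.ball z r, (g w - t) ∂μ := by
        rw [laverage, lintegral_add_left measurable_const, ← laverage, ← laverage,
          setLAverage_const (Metric.measure_ball_pos μ z hr).ne' measure_ball_lt_top.ne]
    _ ≤ _ := add_le_add_right (le_iSup₂_of_le r hr le_rfl) t

lemma lowerSemicontinuous_setLIntegral_ball [OpensMeasurableSpace X] {g : X → ℝ≥0∞}
    (hg : AEMeasurable g μ) (r : ℝ) :
    LowerSemicontinuous fun z => ∫⁻ w in Metric.ball z r, g w ∂μ := by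
  simp_rw [← lintegral_indicator Metric.isOpen_ball.measurableSet]
  refine lowerSemicontinuous_lintegral
    (fun z => hg.indicator Metric.isOpen_ball.measurableSet) (Filter.Eventually.of_forall ?_)
  intro w
  have hswap : (fun z => (Metric.ball z r).indicator g w) =
      (Metric.ball w r).indicator fun _ => g w := by
    classical
    ext z
    simp only [Set.indicator_apply, Metric.mem_ball_comm]
  rw [hswap]
  exact Metric.isOpen_ball.lowerSemicontinuous_indicator zero_le

end Metric

variable {E : Type*} [NormedAddCommGroup E] [MeasurableSpace E] [BorelSpace E] {μ : Measure E}
  [μ.IsAddHaarMeasure] {g : E → ℝ≥0∞}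

lemma lowerSemicontinuous_centeredMaximal (hg : AEMeasurable g μ) :
    LowerSemicontinuous (centeredMaximal μ g) := by
  refine lowerSemicontinuous_biSup fun r hr => ?_
  simp_rw [setLAverage_eq, ENNReal.div_eq_inv_mul, Measure.addHaar_ball_center]
  exact lowerSemicontinuous_const_mul (lowerSemicontinuous_setLIntegral_ball hg r)
    (ENNReal.inv_ne_top.2 (Metric.measure_ball_pos μ 0 hr).ne')

variable [NormedSpace ℝ E] [FiniteDimensional ℝ E] [Nontrivial E]

lemma mul_measure_lt_centeredMaximal_le (g : E → ℝ≥0∞) (t : ℝ≥0∞) :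
    t * μ {z | t < centeredMaximal μ g z} ≤ 2 ^ Module.finrank ℝ E * ∫⁻ w, g w ∂μ := by
  refine mul_measure_le_two_pow_mul_lintegral fun z hz => ?_
  simp only [centeredMaximal, Set.mem_ofPred_eq, lt_iSup_iff] at hz
  obtain ⟨r, hr, hlt⟩ := hz
  refine ⟨r, hr, ?_⟩
  rw [← measure_mul_setLAverage g measure_ball_lt_top.ne, mul_comm]
  exact mul_le_mul_right hlt.le _

lemma mul_measure_lt_centeredMaximal_le_lintegral_tsub (g : E → ℝ≥0∞) {t : ℝ≥0∞} (ht : t ≠ ∞) :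
    t * μ {z | t < centeredMaximal μ g z} ≤
      2 ^ Module.finrank ℝ E * ∫⁻ w, (2 * g w - t) ∂μ := by
  have hsub : {z | t < centeredMaximal μ g z} ⊆
      {z | t < centeredMaximal μ (fun w => 2 * g w - t) z} := fun z hz => by
    have hlt : t + t < t + centeredMaximal μ (fun w => 2 * g w - t) z :=
      calc t + t = 2 * t := (two_mul t).symm
        _ < 2 * centeredMaximal μ g z :=
          ENNReal.mul_lt_mul_right two_ne_zero ENNReal.ofNat_ne_top hz
        _ = centeredMaximal μ (fun w => 2 * g w) z :=
          (centeredMaximal_const_mul g ENNReal.ofNat_ne_top z).symm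
        _ ≤ _ := centeredMaximal_le_add_centeredMaximal_tsub _ t z
    exact (ENNReal.add_lt_add_iff_left ht).1 hlt
  exact (mul_le_mul_right (measure_mono hsub) t).trans (mul_measure_lt_centeredMaximal_le _ t)

theorem lintegral_centeredMaximal_rpow_le (hg : AEMeasurable g μ) {p : ℝ} (hp : 1 < p) :
    ∫⁻ z, centeredMaximal μ g z ^ p ∂μ ≤
      2 ^ Module.finrank ℝ E * ENNReal.ofReal (p - 1)⁻¹ * 2 ^ p * ∫⁻ z, g z ^ p ∂μ := by
  calc ∫⁻ z, centeredMaximal μ g z ^ p ∂μ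
      ≤ 2 ^ Module.finrank ℝ E * ENNReal.ofReal (p - 1)⁻¹ * ∫⁻ z, (2 * g z) ^ p ∂μ :=
        lintegral_rpow_le_of_forall_mul_measure_lt_le
          (lowerSemicontinuous_centeredMaximal hg).measurable.aemeasurable (hg.const_mul 2) hp
          fun t _ => mul_measure_lt_centeredMaximal_le_lintegral_tsub g ENNReal.ofReal_ne_top
    _ = _ := by
        simp_rw [ENNReal.mul_rpow_of_nonneg _ _ (zero_le_one.trans hp.le)]
        rw [lintegral_const_mul'' _ (hg.pow_const p), mul_assoc _ (2 ^ p)]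

end CenteredMaximal

section KernelMaximal

lemma lintegral_mul_comp_add_left {G : Type*} [AddCommGroup G] [MeasurableSpace G]
    [MeasurableAdd G] {μ : Measure G} [μ.IsAddLeftInvariant] (k g : G → ℝ≥0∞) (z : G) :
    ∫⁻ u, k u * g (z + u) ∂μ = ∫⁻ w, k (w - z) * g w ∂μ := by
  rw [← lintegral_add_left_eq_self (fun w => k (w - z) * g w) z]
  simp only [add_sub_cancel_left]

variable {E : Type*} [NormedAddCommGroup E] [MeasurableSpace E] [BorelSpace E] {μ : Measure E}
  {k g : E → ℝ≥0∞} {r : ℝ}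

lemma lintegral_mul_comp_add_left_le [μ.IsAddLeftInvariant] {B : ℝ≥0∞} (hB : B ≠ ∞)
    (hk : ∀ u, k u ≤ (Metric.ball 0 r).indicator (fun _ => B) u) (z : E) :
    ∫⁻ u, k u * g (z + u) ∂μ ≤ B * ∫⁻ w in Metric.ball z r, g w ∂μ := by
  rw [lintegral_mul_comp_add_left, ← lintegral_const_mul' _ _ hB,
    ← lintegral_indicator Metric.isOpen_ball.measurableSet]
  classical
  refine lintegral_mono fun w => (mul_le_mul_left (hk (w - z)) (g w)).trans_eq ?_
  simp only [Set.indicator_apply, Metric.mem_ball, dist_eq_norm, sub_zero, ite_mul, zero_mul]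

lemma ofReal_inv_mul_lintegral_mul_comp_add_left_le [NormedSpace ℝ E] [FiniteDimensional ℝ E]
    [μ.IsAddHaarMeasure] (hr : 0 < r) {B : ℝ≥0∞} (hB : B ≠ ∞)
    (hk : ∀ u, k u ≤ (Metric.ball 0 r).indicator (fun _ => B) u) (z : E) :
    ENNReal.ofReal (r ^ Module.finrank ℝ E)⁻¹ * ∫⁻ u, k u * g (z + u) ∂μ ≤
      B * μ (Metric.ball 0 1) * centeredMaximal μ g z := by
  have hrd : 0 < r ^ Module.finrank ℝ E := pow_pos hr _
  calc _ ≤ ENNReal.ofReal (r ^ Module.finrank ℝ E)⁻¹ *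
        (B * ∫⁻ w in Metric.ball z r, g w ∂μ) :=
        mul_le_mul_right (lintegral_mul_comp_add_left_le hB hk z) _
    _ = ENNReal.ofReal ((r ^ Module.finrank ℝ E)⁻¹ * r ^ Module.finrank ℝ E) *
        (B * μ (Metric.ball 0 1) * ⨍⁻ w in Metric.ball z r, g w ∂μ) := by
        rw [← measure_mul_setLAverage g measure_ball_lt_top.ne, Measure.addHaar_ball_of_pos μ z hr,
          ENNReal.ofReal_mul (inv_pos.2 hrd).le]
        ring
    _ ≤ _ := by
        rw [inv_mul_cancel₀ hrd.ne', ENNReal.ofReal_one, one_mul]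
        gcongr
        exact le_iSup₂_of_le (f := fun s _ => ⨍⁻ w in Metric.ball z s, g w ∂μ) r hr le_rfl

end KernelMaximal

section Chi

lemma Psi_eq_of_mem_Icc {r : ℝ} (hr : r ∈ Set.Icc (0 : ℝ) 1) :
    Psi r = r ^ 6 / 2 + r ^ 3 - 3 / 2 * r ^ 4 := by
  rw [Psi, Set.indicator_of_mem hr]
  rcases eq_or_ne r 0 with rfl | h
  · norm_num
  · field_simp

lemma Psi_nonneg (r : ℝ) : 0 ≤ Psi r := by
  by_cases hr : r ∈ Set.Icc (0 : ℝ) 1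
  · have hfactor : Psi r = r ^ 3 * ((r - 1) ^ 2 * (r + 2) / 2) := by
      rw [Psi_eq_of_mem_Icc hr]
      ring
    have hr₀ : 0 ≤ r := hr.1
    rw [hfactor]
    positivity
  · rw [Psi, Set.indicator_of_notMem hr]

lemma deriv_Psi {r : ℝ} (hr₀ : 0 < r) (hr₁ : r ≤ 1) :
    deriv Psi r = 3 * r ^ 5 + 3 * r ^ 2 - 6 * r ^ 3 := by
  rcases hr₁.eq_or_lt with rfl | hr₁
  · -- `Psi` leaves the polynomial at `1`, but it is nonnegative and vanishes there.
    have hmin : IsLocalMin Psi 1 := Filter.Eventually.of_forall fun x => by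
      rw [Psi_eq_of_mem_Icc (r := 1) (by norm_num)]
      norm_num [Psi_nonneg x]
    rw [hmin.deriv_eq_zero]
    norm_num
  · have hpoly : Psi =ᶠ[nhds r] fun r => r ^ 6 / 2 + r ^ 3 - 3 / 2 * r ^ 4 := by
      filter_upwards [Icc_mem_nhds hr₀ hr₁] with x hx using Psi_eq_of_mem_Icc hx
    rw [hpoly.deriv_eq]
    have hderiv : HasDerivAt (fun r : ℝ => r ^ 6 / 2 + r ^ 3 - 3 / 2 * r ^ 4)
        ((6 : ℕ) * r ^ 5 / 2 + (3 : ℕ) * r ^ 2 - 3 / 2 * ((4 : ℕ) * r ^ 3)) r :=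
      (((hasDerivAt_pow 6 r).div_const 2).add (hasDerivAt_pow 3 r)).sub
        ((hasDerivAt_pow 4 r).const_mul (3 / 2))
    rw [hderiv.deriv]
    push_cast
    ring

lemma rStar_pos : 0 < rStar := by
  have hsqrt : (1 : ℝ) < √5 := by rw [Real.lt_sqrt] <;> norm_num
  rw [rStar]
  linarith

lemma rStar_sq_add_self_sub_one : rStar ^ 2 + rStar - 1 = 0 := by
  have hsqrt : √5 ^ 2 = (5 : ℝ) := Real.sq_sqrt (by norm_num)
  rw [rStar]
  linarith

lemma chi_eq_indicator :
    chi = (Set.Icc rStar 1).indicator fun r => 3 * r * (1 - r) * (r ^ 2 + r - 1) := by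
  ext r
  by_cases hr : r ∈ Set.Icc rStar 1
  · have hr₀ : 0 < r := rStar_pos.trans_le hr.1
    rw [chi, Set.indicator_of_mem hr, Set.indicator_of_mem hr, deriv_Psi hr₀ hr.2]
    field_simp
    ring
  · rw [chi, Set.indicator_of_notMem hr, Set.indicator_of_notMem hr]

lemma continuous_chi : Continuous chi := by
  rw [chi_eq_indicator]
  refine Continuous.indicator (fun r hr => ?_) (by fun_prop)
  have hle : rStar ≤ 1 := by nlinarith [rStar_sq_add_self_sub_one, rStar_pos]
  rw [frontier_Icc hle] at hr
  rcases hr with rfl | hr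
  · rw [rStar_sq_add_self_sub_one, mul_zero]
  · rw [Set.mem_singleton_iff.1 hr]; norm_num

lemma chi_le_one_fourth (r : ℝ) : chi r ≤ 1 / 4 := by
  rw [chi_eq_indicator]
  refine Set.indicator_apply_le' (fun hr => ?_) fun _ => by norm_num
  have hr₀ : 0 < r := rStar_pos.trans_le hr.1
  -- The maximum, about `0.22`, is attained near `r = 0.84`.
  nlinarith [mul_nonneg hr₀.le (sq_nonneg (r - 21 / 25)), sq_nonneg (r ^ 2 - 7 / 10)]

lemma chi_eq_zero {r : ℝ} (hr : 1 ≤ r) : chi r = 0 := by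
  rw [chi_eq_indicator]
  refine Set.indicator_apply_eq_zero.2 fun hmem => ?_
  rw [hmem.2.antisymm hr]
  norm_num

lemma ofReal_chi_norm_div_le {E : Type*} [SeminormedAddGroup E] {r : ℝ} (hr : 0 < r) (u : E) :
    ENNReal.ofReal (chi (‖u‖ / r)) ≤
      (Metric.ball 0 r).indicator (fun _ => ENNReal.ofReal (1 / 4)) u := by
  by_cases hu : u ∈ Metric.ball 0 r
  · rw [Set.indicator_of_mem hu]
    exact ENNReal.ofReal_le_ofReal (chi_le_one_fourth _)
  · rw [chi_eq_zero ((one_le_div₀ hr).2 (by simpa only [mem_ball_zero_iff, not_lt] using hu)),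
      ENNReal.ofReal_zero]
    exact zero_le

end Chi

section MaximalChi

variable {𝕜 : Type*} [RCLike 𝕜] {f : EuclideanSpace ℝ (Fin 3) → 𝕜}

lemma measurable_maximalChi (hf : AEStronglyMeasurable f) : Measurable (maximalChi f) := by
  refine (lowerSemicontinuous_biSup fun r _ =>
    lowerSemicontinuous_const_mul ?_ ENNReal.ofReal_ne_top).measurable
  have hchi : Continuous fun u : EuclideanSpace ℝ (Fin 3) => ENNReal.ofReal (chi (‖u‖ / r)) :=
    ENNReal.continuous_ofReal.comp (continuous_chi.comp (by fun_prop))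
  simp_rw [lintegral_mul_comp_add_left (fun u => ENNReal.ofReal (chi (‖u‖ / r)))
    fun w => ‖f w‖ₑ]
  refine lowerSemicontinuous_lintegral (fun z => ?_) (Filter.Eventually.of_forall fun w => ?_)
  · exact (hchi.measurable.comp (measurable_sub_const z)).aemeasurable.mul hf.enorm
  · exact ((ENNReal.continuous_mul_const enorm_ne_top).comp
      (hchi.comp (by fun_prop))).lowerSemicontinuous

lemma maximalChi_le_centeredMaximal (f : EuclideanSpace ℝ (Fin 3) → 𝕜)
    (z : EuclideanSpace ℝ (Fin 3)) :
    maximalChi f z ≤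
      ENNReal.ofReal (Real.pi / 3) * centeredMaximal volume (fun w => ‖f w‖ₑ) z := by
  have hvol : ENNReal.ofReal (1 / 4) * volume (Metric.ball (0 : EuclideanSpace ℝ (Fin 3)) 1) =
      ENNReal.ofReal (Real.pi / 3) := by
    rw [EuclideanSpace.volume_ball_fin_three, ENNReal.ofReal_one, one_pow, one_mul,
      ← ENNReal.ofReal_mul (by norm_num)]
    ring_nf
  refine iSup₂_le fun r hr => ?_
  have hle := ofReal_inv_mul_lintegral_mul_comp_add_left_le (μ := volume)
    (g := fun w => ‖f w‖ₑ) hr ENNReal.ofReal_ne_top (ofReal_chi_norm_div_le hr) z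
  rwa [finrank_euclideanSpace_fin, hvol] at hle

lemma lintegral_maximalChi_sq_le (hf : AEStronglyMeasurable f) :
    ∫⁻ z, maximalChi f z ^ 2 ≤ ENNReal.ofReal (32 * (Real.pi / 3) ^ 2) * ∫⁻ z, ‖f z‖ₑ ^ 2 := by
  have hmax : ∫⁻ z, centeredMaximal volume (fun w => ‖f w‖ₑ) z ^ 2 ≤ 32 * ∫⁻ z, ‖f z‖ₑ ^ 2 := by
    have hle := lintegral_centeredMaximal_rpow_le hf.enorm one_lt_two
    norm_num [finrank_euclideanSpace_fin] at hle
    exact hle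
  calc ∫⁻ z, maximalChi f z ^ 2
      ≤ ∫⁻ z, (ENNReal.ofReal (Real.pi / 3) * centeredMaximal volume (fun w => ‖f w‖ₑ) z) ^ 2 :=
        lintegral_mono fun z => pow_le_pow_left' (maximalChi_le_centeredMaximal f z) 2
    _ = ENNReal.ofReal (Real.pi / 3) ^ 2 *
          ∫⁻ z, centeredMaximal volume (fun w => ‖f w‖ₑ) z ^ 2 := by
        simp_rw [mul_pow]
        exact lintegral_const_mul' _ _ (ENNReal.pow_ne_top ENNReal.ofReal_ne_top)
    _ ≤ ENNReal.ofReal (Real.pi / 3) ^ 2 * (32 * ∫⁻ z, ‖f z‖ₑ ^ 2) := by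
        gcongr
    _ = _ := by
        rw [← mul_assoc, mul_comm _ 32, ENNReal.ofReal_mul (by norm_num), ENNReal.ofReal_ofNat,
          ENNReal.ofReal_pow (by positivity)]

theorem lemma1_general (hf : AEStronglyMeasurable f) :
    Measurable (maximalChi f) ∧
      (∫⁻ z, maximalChi f z ^ 2) ^ (1 / 2 : ℝ) ≤
        ENNReal.ofReal 7.5831 * (∫⁻ z, ‖f z‖ₑ ^ 2) ^ (1 / 2 : ℝ) := by
  refine ⟨measurable_maximalChi hf, ?_⟩
  have hconst : 32 * (Real.pi / 3) ^ 2 ≤ (7.5831 : ℝ) ^ 2 := by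
    nlinarith [Real.pi_pos, Real.pi_lt_d2]
  calc (∫⁻ z, maximalChi f z ^ 2) ^ (1 / 2 : ℝ)
      ≤ (ENNReal.ofReal 7.5831 ^ 2 * ∫⁻ z, ‖f z‖ₑ ^ 2) ^ (1 / 2 : ℝ) := by
        rw [← ENNReal.ofReal_pow (by norm_num)]
        gcongr
        exact (lintegral_maximalChi_sq_le hf).trans
          (mul_le_mul_left (ENNReal.ofReal_le_ofReal hconst) _)
    _ = _ := by
        rw [ENNReal.mul_rpow_of_nonneg _ _ (by norm_num), ← ENNReal.rpow_two, ← ENNReal.rpow_mul]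
        norm_num

end MaximalChi

theorem lemma1 {𝕜 : Type*} [RCLike 𝕜] (f : EuclideanSpace ℝ (Fin 3) → 𝕜)
    (hf : MemLp f 2 volume) :
    Measurable (maximalChi f) ∧
      (∫⁻ z, maximalChi f z ^ 2) ^ (1 / 2 : ℝ) ≤
        ENNReal.ofReal 7.5831 * (∫⁻ z, ‖f z‖ₑ ^ 2) ^ (1 / 2 : ℝ) :=
  lemma1_general hf.aestronglyMeasurable
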